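/- Let $G$ be a finite simple graph on $n\ge 1$ vertices. Let $\mathcal{S}_L(G)$ be the set of weighted Laplacian matrices of $G$, that is, of all $n\times n$ real symmetric matrices $A=[a_{i,j}]$, indexed by the vertices of $G$, such that $a_{i,j}<0$ if $\{i,j\}\in E(G)$, $a_{i,j}=0$ if $i\ne j$ and $\{i,j\}\notin E(G)$, and $a_{i,i}=-\sum_{k:\,k\sim i}a_{i,k}$ for every $i$. Let $H=I-\frac1n J$, where $I$ is the $n\times n$ identity matrix and $J$ is the $n\times n$ all-ones matrix, and let $\circ$ denote the entrywise product of matrices. A matrix $A\in\mathcal{S}_L(G)$ has the strong spectral property for weighted Laplacian matrices (SSPWL) if $X=O$ is the only real symmetric $n\times n$ matrix such that $A\circ X=I\circ X=O$ and $H(AX-XA)H=O$. Then $\mathcal{S}_L(G)$ contains a matrix with the SSPWL if and only if $G$ is connected. -/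

import Mathlib

open scoped Matrix

/-- The set of weighted Laplacian matrices of the graph `G`. -/
def weightedLaplacians {V : Type*} [Fintype V] (G : SimpleGraph V) [DecidableRel G.Adj] :
    Set (Matrix V V ℝ) :=
  {A | A.IsSymm ∧
    (∀ i j, G.Adj i j → A i j < 0) ∧
    (∀ i j, i ≠ j → ¬ G.Adj i j → A i j = 0) ∧
    (∀ i, A i i = -∑ k ∈ G.neighborFinset i, A i k)}

/-- `H = I - (1/n) J`, the orthogonal projection onto the complement of the all-ones vector. -/
noncomputable def centeringMatrix (V : Type*) [Fintype V] [DecidableEq V] : Matrix V V ℝ :=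
  1 - (1 / (Fintype.card V : ℝ)) • Matrix.of (fun _ _ => (1 : ℝ))

/-- The strong spectral property for weighted Laplacian matrices. -/
def HasSSPWL {V : Type*} [Fintype V] [DecidableEq V] (A : Matrix V V ℝ) : Prop :=
  ∀ X : Matrix V V ℝ, X.IsSymm → A ⊙ X = 0 → (1 : Matrix V V ℝ) ⊙ X = 0 →
    centeringMatrix V * (A * X - X * A) * centeringMatrix V = 0 → X = 0

/-! If `G` is disconnected, the 0-1 matrix of the pairs separated by a component is annihilated by
every weighted Laplacian on both sides, so the SSPWL fails. Conversely, for skew `K = AX - XA`, the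
equation `HKH = 0` makes `K i j` a difference `c i - c j`. The resulting property `HasCocycleSSP`
asks `X` to vanish on the edges of `G` rather than on the support of `A`, so it makes sense for
matrices with too few nonzero entries. Induct by deleting a non-cut vertex: bordering a good matrix
by zeros keeps the property (`HasCocycleSSP.zeroExtend`). It is also an open condition, so adding a
small multiple of the Laplacian of `G` repairs the missing edges without losing it. -/

section RowSums

variable {V : Type*} [Fintype V]

theorem sum_row_eq_add_sum_neighborFinset {G : SimpleGraph V} [DecidableRel G.Adj]
    {A : Matrix V V ℝ} (h0 : ∀ i j, i ≠ j → ¬ G.Adj i j → A i j = 0) (i : V) :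
    ∑ k, A i k = A i i + ∑ k ∈ G.neighborFinset i, A i k := by
  classical
  rw [← Finset.add_sum_erase _ _ (Finset.mem_univ i)]
  congr 1
  refine (Finset.sum_subset (fun k hk => ?_) (fun k hk hk' => ?_)).symm
  · rw [SimpleGraph.mem_neighborFinset] at hk
    simpa using hk.ne'
  · rw [SimpleGraph.mem_neighborFinset] at hk'
    exact h0 i k (by simpa [eq_comm] using hk) hk'

theorem sum_row_eq_zero_of_mem_weightedLaplacians {G : SimpleGraph V} [DecidableRel G.Adj]
    {A : Matrix V V ℝ} (hA : A ∈ weightedLaplacians G) (i : V) : ∑ k, A i k = 0 := by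
  rw [sum_row_eq_add_sum_neighborFinset hA.2.2.1, hA.2.2.2 i, neg_add_cancel]

theorem mem_weightedLaplacians_of_sum_row_eq_zero {G : SimpleGraph V} [DecidableRel G.Adj]
    {A : Matrix V V ℝ} (hs : A.IsSymm) (hneg : ∀ i j, G.Adj i j → A i j < 0)
    (h0 : ∀ i j, i ≠ j → ¬ G.Adj i j → A i j = 0) (hr : ∀ i, ∑ k, A i k = 0) :
    A ∈ weightedLaplacians G :=
  ⟨hs, hneg, h0, fun i =>
    eq_neg_of_add_eq_zero_left ((sum_row_eq_add_sum_neighborFinset h0 i).symm.trans (hr i))⟩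

end RowSums

section Necessity

variable {V : Type*} [Fintype V] [DecidableEq V]

/-- The indicator of the pairs separated by a union of components violates the SSPWL. -/
theorem connected_of_hasSSPWL [Nonempty V] {G : SimpleGraph V} [DecidableRel G.Adj]
    {A : Matrix V V ℝ} (hA : A ∈ weightedLaplacians G) (h : HasSSPWL A) : G.Connected := by
  classical
  refine ⟨fun u w => ?_⟩
  by_contra huw
  have hrow := sum_row_eq_zero_of_mem_weightedLaplacians hA
  obtain ⟨hs, -, h0, -⟩ := hA
  let X : Matrix V V ℝ :=
    Matrix.of fun i j => if (G.Reachable u i ↔ G.Reachable u j) then 0 else 1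
  have hXs : X.IsSymm := Matrix.IsSymm.ext fun i j => by simp [X, iff_comm]
  have hreach : ∀ i j, A i j ≠ 0 → (G.Reachable u i ↔ G.Reachable u j) := by
    intro i j hij
    by_cases hne : i = j
    · rw [hne]
    · have hadj : G.Adj i j := by
        by_contra hadj
        exact hij (h0 i j hne hadj)
      exact ⟨fun hi => hi.trans hadj.reachable, fun hj => hj.trans hadj.symm.reachable⟩
  -- Row `i` of `A` only meets rows of `X` equal to row `i`, so `A * X` scales that row by a row sum
  -- of `A`, which is zero.
  have hAX : A * X = 0 := by
    ext i j
    have : ∀ k, A i k * X k j = A i k * X i j := by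
      intro k
      by_cases hk : A i k = 0
      · simp [hk]
      · simp [X, hreach i k hk]
    rw [Matrix.mul_apply, Finset.sum_congr rfl fun k _ => this k, ← Finset.sum_mul, hrow i]
    simp
  have hXA : X * A = 0 := by
    have := congrArg Matrix.transpose hAX
    rwa [Matrix.transpose_mul, hs.eq, hXs.eq, Matrix.transpose_zero] at this
  have hX := h X hXs ?_ ?_ ?_
  · have := congrFun (congrFun hX u) w
    simp [X, huw] at this
  · ext i j
    by_cases hij : A i j = 0
    · simp [hij]
    · simp [X, hreach i j hij]
  · ext i j
    by_cases hij : i = j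
    · simp [X, hij]
    · simp [hij]
  · rw [hAX, hXA]
    simp

end Necessity

section Cocycle

variable {V : Type*} [Fintype V]

/-- The only symmetric matrix `X` vanishing on the diagonal and on the edges of `G` whose commutator
with `A` has the form `c i - c j`, is zero. That form is expressed by a cocycle identity. -/
def HasCocycleSSP (G : SimpleGraph V) (A : Matrix V V ℝ) : Prop :=
  ∀ X : Matrix V V ℝ, X.IsSymm → (∀ i, X i i = 0) → (∀ i j, G.Adj i j → X i j = 0) →
    (∀ i j k, (A * X - X * A) i j + (A * X - X * A) j k + (A * X - X * A) k i = 0) → X = 0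

theorem centeringMatrix_mul_mul_apply [DecidableEq V] (K : Matrix V V ℝ) (i j : V) :
    (centeringMatrix V * K * centeringMatrix V) i j =
      K i j - (1 / (Fintype.card V : ℝ)) * ∑ l, K l j - (1 / (Fintype.card V : ℝ)) * ∑ l, K i l
        + (1 / (Fintype.card V : ℝ)) * ((1 / (Fintype.card V : ℝ)) * ∑ l, ∑ m, K m l) := by
  have h1 : ∀ i j, (centeringMatrix V * K) i j =
      K i j - (1 / (Fintype.card V : ℝ)) * ∑ l, K l j := by
    intro i j
    rw [centeringMatrix, sub_mul, one_mul]
    simp [Matrix.mul_apply, Finset.mul_sum]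
  have h2 : (centeringMatrix V * K * centeringMatrix V) i j =
      (centeringMatrix V * K) i j
        - (1 / (Fintype.card V : ℝ)) * ∑ l, (centeringMatrix V * K) i l := by
    generalize centeringMatrix V * K = M
    rw [centeringMatrix, mul_sub, mul_one]
    simp [Matrix.mul_apply, ← Finset.sum_mul, mul_comm]
  rw [h2]
  simp only [h1, Finset.sum_sub_distrib, ← Finset.mul_sum]
  ring

/-- Double centering subtracts row and column means. For skew `K` these are opposite and the total
is zero, so `K i j` is the mean of row `i` minus that of row `j`. -/
theorem cocycle_of_centering_eq_zero [DecidableEq V] {K : Matrix V V ℝ} (hK : Kᵀ = -K)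
    (h : centeringMatrix V * K * centeringMatrix V = 0) (i j k : V) :
    K i j + K j k + K k i = 0 := by
  have hskew : ∀ i j, K i j = - K j i := fun i j => by
    simpa using congrFun (congrFun hK j) i
  have hcol : ∀ j, ∑ l, K l j = - ∑ l, K j l := fun j => by
    rw [← Finset.sum_neg_distrib]
    exact Finset.sum_congr rfl fun l _ => hskew l j
  have htot : ∑ l, ∑ m, K m l = 0 := by
    have h1 : ∑ l, ∑ m, K m l = - ∑ l, ∑ m, K l m := by
      rw [← Finset.sum_neg_distrib]
      exact Finset.sum_congr rfl fun l _ => hcol l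
    rw [Finset.sum_comm (f := fun l m => K l m)] at h1
    linarith
  have hij : ∀ i j, K i j + (1 / (Fintype.card V : ℝ)) * ∑ l, K j l
      - (1 / (Fintype.card V : ℝ)) * ∑ l, K i l = 0 := fun i j => by
    have := congrFun (congrFun h i) j
    rw [centeringMatrix_mul_mul_apply, htot, hcol] at this
    simp only [Matrix.zero_apply] at this
    linarith
  linarith [hij i j, hij j k, hij k i]

theorem HasCocycleSSP.hasSSPWL [DecidableEq V] {G : SimpleGraph V} [DecidableRel G.Adj]
    {A : Matrix V V ℝ} (hA : A ∈ weightedLaplacians G) (h : HasCocycleSSP G A) : HasSSPWL A := by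
  intro X hX hAX hdiag hH
  refine h X hX (fun i => ?_) (fun i j hij => ?_) (cocycle_of_centering_eq_zero ?_ hH)
  · simpa using congrFun (congrFun hdiag i) i
  · have := congrFun (congrFun hAX i) j
    simpa [(hA.2.1 i j hij).ne] using this
  · rw [Matrix.transpose_sub, Matrix.transpose_mul, Matrix.transpose_mul, hX.eq, hA.1.eq]
    abel

end Cocycle

section Kernel

variable {V : Type*} [Fintype V]

/-- The kernel of a weighted Laplacian of a connected graph consists of constant vectors. -/
theorem eq_of_mulVec_eq_zero {G : SimpleGraph V} [DecidableRel G.Adj] (hG : G.Connected)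
    {A : Matrix V V ℝ} (hA : A ∈ weightedLaplacians G) {x : V → ℝ} (hx : A *ᵥ x = 0) (i j : V) :
    x i = x j := by
  have hrow := sum_row_eq_zero_of_mem_weightedLaplacians hA
  obtain ⟨hs, hneg, h0, -⟩ := hA
  have hx' : ∀ i, ∑ j, A i j * x j = 0 := fun i => by
    simpa [Matrix.mulVec, dotProduct] using congrFun hx i
  -- With zero row and column sums, this sum is `-2 xᵀAx`; all its terms are nonpositive.
  have hquad : ∑ i, ∑ j, A i j * (x i - x j) ^ 2 = 0 := by
    have e1 : ∀ i j, A i j * (x i - x j) ^ 2 =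
        x i ^ 2 * A i j - 2 * x i * (A i j * x j) + A i j * x j ^ 2 := fun i j => by ring
    have e2 : ∑ i, ∑ j, A i j * x j ^ 2 = 0 := by
      rw [Finset.sum_comm]
      refine Finset.sum_eq_zero fun j _ => ?_
      rw [← Finset.sum_mul, Finset.sum_congr rfl fun i _ => (hs.apply i j).symm, hrow, zero_mul]
    simp only [e1, Finset.sum_add_distrib, Finset.sum_sub_distrib, ← Finset.mul_sum, hrow, hx', e2]
    simp
  have hnonpos : ∀ i j, A i j * (x i - x j) ^ 2 ≤ 0 := by
    intro i j
    by_cases hij : i = j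
    · simp [hij]
    by_cases hadj : G.Adj i j
    · exact mul_nonpos_of_nonpos_of_nonneg (hneg i j hadj).le (sq_nonneg _)
    · simp [h0 i j hij hadj]
  have hadj : ∀ i j, G.Adj i j → x i = x j := by
    intro i j hij
    have h1 := (Finset.sum_eq_zero_iff_of_nonpos
      fun i _ => Finset.sum_nonpos fun j _ => hnonpos i j).1 hquad i (Finset.mem_univ i)
    have h2 := (Finset.sum_eq_zero_iff_of_nonpos
      fun j _ => hnonpos i j).1 h1 j (Finset.mem_univ j)
    simpa [(hneg i j hij).ne, sub_eq_zero] using h2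
  obtain ⟨p⟩ := hG.preconnected i j
  induction p with
  | nil => rfl
  | cons h _ ih => exact (hadj _ _ h).trans ih

end Kernel

section Perturbation

theorem Module.Basis.injective_iff_linearIndependent {ι R M N : Type*} [Fintype ι] [Ring R]
    [AddCommGroup M] [AddCommGroup N] [Module R M] [Module R N] (b : Module.Basis ι R M)
    (f : M →ₗ[R] N) : Function.Injective f ↔ LinearIndependent R fun i => f (b i) := by
  constructor
  · intro hf
    exact b.linearIndependent.map' f (LinearMap.ker_eq_bot.2 hf)
  · intro hf
    refine (injective_iff_map_eq_zero f).2 fun x hx => ?_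
    rw [← b.sum_repr x, map_sum] at hx
    simp only [map_smul] at hx
    have := Fintype.linearIndependent_iff.1 hf _ hx
    rw [← b.sum_repr x]
    simp [this]

variable {V : Type*} [Fintype V]

/-- Symmetric matrices that vanish on the diagonal and on the edges of `G`. -/
def nonedgeSubmodule (G : SimpleGraph V) : Submodule ℝ (Matrix V V ℝ) where
  carrier := {X | X.IsSymm ∧ (∀ i, X i i = 0) ∧ ∀ i j, G.Adj i j → X i j = 0}
  add_mem' := by
    rintro X Y ⟨h1, h2, h3⟩ ⟨g1, g2, g3⟩
    exact ⟨h1.add g1, fun i => by simp [h2, g2], fun i j h => by simp [h3 i j h, g3 i j h]⟩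
  zero_mem' := ⟨Matrix.isSymm_zero, fun _ => rfl, fun _ _ _ => rfl⟩
  smul_mem' := by
    rintro c X ⟨h1, h2, h3⟩
    exact ⟨h1.smul c, fun i => by simp [h2], fun i j h => by simp [h3 i j h]⟩

/-- The coboundary of the commutator with `A`. -/
def commutatorCoboundary (A : Matrix V V ℝ) : Matrix V V ℝ →ₗ[ℝ] (V → V → V → ℝ) where
  toFun X := fun i j k =>
    (A * X - X * A) i j + (A * X - X * A) j k + (A * X - X * A) k i
  map_add' X Y := by
    ext i j k
    simp only [mul_add, add_mul, Matrix.sub_apply, Matrix.add_apply, Pi.add_apply]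
    ring
  map_smul' c X := by
    ext i j k
    simp only [Matrix.mul_smul, Matrix.smul_mul, Matrix.sub_apply, Matrix.smul_apply, Pi.smul_apply,
      smul_eq_mul, RingHom.id_apply]
    ring

theorem hasCocycleSSP_iff_injective {G : SimpleGraph V} {A : Matrix V V ℝ} :
    HasCocycleSSP G A ↔
      Function.Injective ((commutatorCoboundary A).domRestrict (nonedgeSubmodule G)) := by
  rw [injective_iff_map_eq_zero]
  constructor
  · rintro h ⟨X, h1, h2, h3⟩ hX
    exact Subtype.ext (h X h1 h2 h3 fun i j k => congrFun (congrFun (congrFun hX i) j) k)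
  · intro h X h1 h2 h3 hX
    exact congrArg Subtype.val (h ⟨X, h1, h2, h3⟩ (funext fun i => funext fun j => funext (hX i j)))

/-- The space of admissible `X` depends only on `G`. The property says that the images of a fixed
basis are linearly independent, an open condition, and these images vary continuously with `ε`. -/
theorem HasCocycleSSP.exists_pos_add_smul {G : SimpleGraph V} {A : Matrix V V ℝ}
    (h : HasCocycleSSP G A) (L : Matrix V V ℝ) : ∃ ε : ℝ, 0 < ε ∧ HasCocycleSSP G (A + ε • L) := by
  let b := Module.finBasis ℝ (nonedgeSubmodule G)
  have key : ∀ B : Matrix V V ℝ, HasCocycleSSP G B ↔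
      LinearIndependent ℝ fun i => commutatorCoboundary B (b i : Matrix V V ℝ) := by
    intro B
    rw [hasCocycleSSP_iff_injective, b.injective_iff_linearIndependent]
    rfl
  have hcont : Continuous fun ε : ℝ =>
      fun i => commutatorCoboundary (A + ε • L) (b i : Matrix V V ℝ) := by
    refine continuous_pi fun m => continuous_pi fun i => continuous_pi fun j =>
      continuous_pi fun k => ?_
    simp only [commutatorCoboundary, LinearMap.coe_mk, AddHom.coe_mk, Matrix.sub_apply,
      Matrix.mul_apply, Matrix.add_apply, Matrix.smul_apply]
    fun_prop
  have hopen := (isOpen_setOfPred_linearIndependent (𝕜 := ℝ) (E := V → V → V → ℝ)).preimage hcont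
  have h0 : (0 : ℝ) ∈ (fun ε : ℝ => fun i => commutatorCoboundary (A + ε • L)
      (b i : Matrix V V ℝ)) ⁻¹' {f | LinearIndependent ℝ f} := by
    simpa using (key A).1 h
  obtain ⟨ε, hε, hball⟩ := Metric.isOpen_iff.1 hopen 0 h0
  refine ⟨ε / 2, by positivity, (key _).2 (hball ?_)⟩
  rw [Metric.mem_ball, dist_zero_right, Real.norm_eq_abs, abs_of_pos (by positivity)]
  linarith

end Perturbation

section Extension

variable {V : Type*} [DecidableEq V]

/-- Extend a matrix indexed by the complement of `v` by a zero row and a zero column at `v`. -/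
def zeroExtend (v : V) (A : Matrix ({v}ᶜ : Set V) ({v}ᶜ : Set V) ℝ) : Matrix V V ℝ :=
  Matrix.of fun i j => if h : i ≠ v ∧ j ≠ v then A ⟨i, h.1⟩ ⟨j, h.2⟩ else 0

variable {v : V} {A : Matrix ({v}ᶜ : Set V) ({v}ᶜ : Set V) ℝ}

theorem zeroExtend_apply_coe (i j : ({v}ᶜ : Set V)) : zeroExtend v A i j = A i j := by
  have hi : (i : V) ≠ v := i.2
  have hj : (j : V) ≠ v := j.2
  simp [zeroExtend, hi, hj]

theorem zeroExtend_apply_left (j : V) : zeroExtend v A v j = 0 := by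
  simp [zeroExtend]

theorem zeroExtend_apply_right (i : V) : zeroExtend v A i v = 0 := by
  simp [zeroExtend]

theorem Matrix.IsSymm.zeroExtend (hA : A.IsSymm) : (zeroExtend v A).IsSymm := by
  refine Matrix.IsSymm.ext fun i j => ?_
  by_cases hi : i = v
  · rw [hi, zeroExtend_apply_left, zeroExtend_apply_right]
  by_cases hj : j = v
  · rw [hj, zeroExtend_apply_left, zeroExtend_apply_right]
  lift i to ({v}ᶜ : Set V) using hi
  lift j to ({v}ᶜ : Set V) using hj
  rw [zeroExtend_apply_coe, zeroExtend_apply_coe, hA.apply]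

variable [Fintype V]

theorem sum_eq_add_sum_compl_singleton (v : V) (f : V → ℝ) :
    ∑ i, f i = f v + ∑ i : ({v}ᶜ : Set V), f i := by
  rw [← Finset.add_sum_erase _ _ (Finset.mem_univ v)]
  congr 1
  exact Finset.sum_subtype _ (fun i => by simp) f

theorem zeroExtend_mul_apply (X : Matrix V V ℝ) (i : ({v}ᶜ : Set V)) (j : V) :
    (zeroExtend v A * X) i j = ∑ k : ({v}ᶜ : Set V), A i k * X k j := by
  rw [Matrix.mul_apply, sum_eq_add_sum_compl_singleton v, zeroExtend_apply_right, zero_mul, zero_add]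
  simp only [zeroExtend_apply_coe]

theorem mul_zeroExtend_apply (X : Matrix V V ℝ) (i : V) (j : ({v}ᶜ : Set V)) :
    (X * zeroExtend v A) i j = ∑ k : ({v}ᶜ : Set V), X i k * A k j := by
  rw [Matrix.mul_apply, sum_eq_add_sum_compl_singleton v, zeroExtend_apply_left, mul_zero, zero_add]
  simp only [zeroExtend_apply_coe]

theorem mul_zeroExtend_apply_right (X : Matrix V V ℝ) (i : V) :
    (X * zeroExtend v A) i v = 0 := by
  rw [Matrix.mul_apply]
  exact Finset.sum_eq_zero fun k _ => by rw [zeroExtend_apply_right, mul_zero]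

/-- The property of `A` kills the block of `X` off `v`. Only the column `x` at `v` remains, and it
enters the commutator as `A *ᵥ x`. This vector is constant and sums to zero, hence vanishes, so `x`
is constant; it is zero at the neighbor `w`. -/
theorem HasCocycleSSP.zeroExtend {G : SimpleGraph V} [DecidableRel (G.induce {v}ᶜ).Adj]
    (hG : (G.induce {v}ᶜ).Connected) {w : V} (hvw : G.Adj w v)
    (hA : A ∈ weightedLaplacians (G.induce {v}ᶜ)) (h : HasCocycleSSP (G.induce {v}ᶜ) A) :
    HasCocycleSSP G (zeroExtend v A) := by
  intro X hXs hXd hXe hK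
  have hblock : ∀ i j : ({v}ᶜ : Set V), X i j = 0 := by
    let Y : Matrix ({v}ᶜ : Set V) ({v}ᶜ : Set V) ℝ := X.submatrix (↑) (↑)
    have hY : Y = 0 := by
      refine h Y (hXs.submatrix _) (fun i => hXd i) (fun i j hij => hXe i j hij) fun i j k => ?_
      have hc : ∀ i j : ({v}ᶜ : Set V), (A * Y - Y * A) i j =
          (_root_.zeroExtend v A * X - X * _root_.zeroExtend v A) i j := fun i j => by
        rw [Matrix.sub_apply, Matrix.sub_apply, zeroExtend_mul_apply, mul_zeroExtend_apply]
        rfl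
      rw [hc, hc, hc]
      exact hK i j k
    exact fun i j => congrFun (congrFun hY i) j
  have hzero : ∀ i j : ({v}ᶜ : Set V),
      (_root_.zeroExtend v A * X - X * _root_.zeroExtend v A) i j = 0 := fun i j => by
    rw [Matrix.sub_apply, zeroExtend_mul_apply, mul_zeroExtend_apply]
    simp [hblock]
  let x : ({v}ᶜ : Set V) → ℝ := fun i => X i v
  have hcol : ∀ i : ({v}ᶜ : Set V),
      (_root_.zeroExtend v A * X - X * _root_.zeroExtend v A) i v = (A *ᵥ x) i := fun i => by
    rw [Matrix.sub_apply, zeroExtend_mul_apply, mul_zeroExtend_apply_right, sub_zero]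
    rfl
  have hconst : ∀ i j, (A *ᵥ x) i = (A *ᵥ x) j := fun i j => by
    -- The triples `(v, v, v)` and `(j, v, v)` give skewness between the row and the column at `v`.
    have h1 := hK i v j
    have h2 := hK j v v
    have h3 := hK v v v
    rw [hzero, hcol] at h1
    rw [hcol] at h2
    linarith
  have hsum : ∑ i, (A *ᵥ x) i = 0 := by
    simp only [Matrix.mulVec, dotProduct]
    rw [Finset.sum_comm]
    refine Finset.sum_eq_zero fun j _ => ?_
    rw [← Finset.sum_mul, Finset.sum_congr rfl fun i _ => (hA.1.apply i j).symm,
      sum_row_eq_zero_of_mem_weightedLaplacians hA, zero_mul]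
  have hAx : A *ᵥ x = 0 := by
    funext i
    rw [Finset.sum_congr rfl fun j _ => hconst j i] at hsum
    rw [Finset.sum_const, smul_eq_zero] at hsum
    exact hsum.resolve_left (Finset.card_ne_zero_of_mem (Finset.mem_univ i))
  have hx : ∀ i : ({v}ᶜ : Set V), X i v = 0 := fun i =>
    (eq_of_mulVec_eq_zero hG hA hAx i ⟨w, hvw.ne⟩).trans (hXe w v hvw)
  ext i j
  by_cases hi : i = v
  · by_cases hj : j = v
    · rw [hi, hj]
      exact hXd v
    · rw [hi, ← hXs.apply]
      exact hx ⟨j, hj⟩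
  · by_cases hj : j = v
    · rw [hj]
      exact hx ⟨i, hi⟩
    · exact hblock ⟨i, hi⟩ ⟨j, hj⟩

/-- The Laplacian puts `-ε` on the edges at `v`, where the extension is zero, and only lowers the
other edge entries. -/
theorem zeroExtend_add_smul_lapMatrix_mem {G : SimpleGraph V} [DecidableRel G.Adj]
    [DecidableRel (G.induce {v}ᶜ).Adj] (hA : A ∈ weightedLaplacians (G.induce {v}ᶜ)) {ε : ℝ}
    (hε : 0 < ε) : zeroExtend v A + ε • G.lapMatrix ℝ ∈ weightedLaplacians G := by
  have hlap : ∀ i j, i ≠ j → G.lapMatrix ℝ i j = if G.Adj i j then -1 else 0 := fun i j hij => by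
    by_cases h : G.Adj i j <;>
    simp [SimpleGraph.lapMatrix, SimpleGraph.degMatrix, hij, h]
  refine mem_weightedLaplacians_of_sum_row_eq_zero ?_ (fun i j hij => ?_) (fun i j hne hij => ?_)
    fun i => ?_
  · exact hA.1.zeroExtend.add ((G.isSymm_lapMatrix (R := ℝ)).smul ε)
  · have hnonpos : zeroExtend v A i j ≤ 0 := by
      by_cases hi : i = v
      · rw [hi, zeroExtend_apply_left]
      by_cases hj : j = v
      · rw [hj, zeroExtend_apply_right]
      lift i to ({v}ᶜ : Set V) using hi
      lift j to ({v}ᶜ : Set V) using hj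
      rw [zeroExtend_apply_coe]
      exact (hA.2.1 i j hij).le
    rw [Matrix.add_apply, Matrix.smul_apply, hlap i j hij.ne, if_pos hij, smul_eq_mul]
    linarith
  · have hz : zeroExtend v A i j = 0 := by
      by_cases hi : i = v
      · rw [hi, zeroExtend_apply_left]
      by_cases hj : j = v
      · rw [hj, zeroExtend_apply_right]
      lift i to ({v}ᶜ : Set V) using hi
      lift j to ({v}ᶜ : Set V) using hj
      rw [zeroExtend_apply_coe]
      exact hA.2.2.1 i j (fun h => hne (congrArg _ h)) hij
    rw [Matrix.add_apply, Matrix.smul_apply, hlap i j hne, if_neg hij, hz, smul_zero, add_zero]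
  · have h1 : ∑ k, zeroExtend v A i k = 0 := by
      rw [sum_eq_add_sum_compl_singleton v, zeroExtend_apply_right, zero_add]
      by_cases hi : i = v
      · rw [hi]
        exact Finset.sum_eq_zero fun k _ => zeroExtend_apply_left _
      lift i to ({v}ᶜ : Set V) using hi
      simp only [zeroExtend_apply_coe]
      exact sum_row_eq_zero_of_mem_weightedLaplacians hA i
    have h2 : ∑ k, G.lapMatrix ℝ i k = 0 := by
      have := congrFun (G.lapMatrix_mulVec_const_eq_zero (R := ℝ)) i
      simpa [Matrix.mulVec, dotProduct] using this
    simp only [Matrix.add_apply, Matrix.smul_apply, Finset.sum_add_distrib, ← Finset.smul_sum, h1,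
      h2, smul_zero, add_zero]

end Extension

theorem SimpleGraph.Connected.exists_hasCocycleSSP {V : Type*} [Fintype V] {G : SimpleGraph V}
    [DecidableRel G.Adj] (hG : G.Connected) :
    ∃ A ∈ weightedLaplacians G, HasCocycleSSP G A := by
  induction hn : Fintype.card V using Nat.strong_induction_on generalizing V with
  | _ n ih =>
    subst hn
    have := Classical.decEq V
    have := hG.nonempty
    rcases subsingleton_or_nontrivial V with hV | hV
    · refine ⟨0, mem_weightedLaplacians_of_sum_row_eq_zero Matrix.isSymm_zero
        (fun i j hij => (hij.ne (Subsingleton.elim i j)).elim) (fun _ _ _ _ => rfl)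
        (fun i => by simp), fun X _ hd _ _ => ?_⟩
      ext i j
      rw [Subsingleton.elim j i]
      exact hd i
    -- Here `v` is a non-cut vertex, so the induction hypothesis applies to its complement.
    · obtain ⟨v, hv⟩ := hG.exists_connected_induce_compl_singleton_of_finite_nontrivial
      obtain ⟨w, hw⟩ := hG.preconnected.exists_adj_of_nontrivial v
      obtain ⟨A, hA, hSSP⟩ := ih (Fintype.card ({v}ᶜ : Set V))
        (Fintype.card_subtype_lt (x := v) (by simp)) hv rfl
      obtain ⟨ε, hε, h⟩ := (hSSP.zeroExtend hv hw.symm hA).exists_pos_add_smul (G.lapMatrix ℝ)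
      exact ⟨_, zeroExtend_add_smul_lapMatrix_mem hA hε, h⟩

theorem mainTheorem2 {V : Type*} [Fintype V] [DecidableEq V] [Nonempty V]
    (G : SimpleGraph V) [DecidableRel G.Adj] :
    (∃ A ∈ weightedLaplacians G, HasSSPWL A) ↔ G.Connected := by
  constructor
  · rintro ⟨A, hA, h⟩
    exact connected_of_hasSSPWL hA h
  · intro hG
    obtain ⟨A, hA, h⟩ := hG.exists_hasCocycleSSP
    exact ⟨A, hA, h.hasSSPWL hA⟩
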